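/- Let $X$ be a nonempty measurable space, let $\mathcal G$ be a set of probability measures on $X$ having densities $\rho_\nu$ ($\nu\in\mathcal G$) with respect to a common $\sigma$-finite measure, and let $\mathcal F$ be a nonempty set of measurable functions $X\to\mathbb R$. Assume: (A1) for all $\nu_1,\nu_2\in\mathcal G$, $\log(\rho_{\nu_1}/\rho_{\nu_2})$ is of the form $w_0+\sum_{i=1}^n w_if_i$ with $n\in\mathbb N$, $w_i\in\mathbb R$, $f_i\in\mathcal F$; (A2) $f\in\mathcal F$ implies $-f\in\mathcal F$, and $|f(x)|\le\Delta$ for all $f\in\mathcal F$, $x\in X$, where $\Delta>0$; (A3) $\mathcal F=\{f_\theta:\theta\in\Theta\}$ with $\Theta\subseteq[-1,1]^p$ and $\sup_x|f_\theta(x)-f_{\theta'}(x)|\le L\|\theta-\theta'\|_2$, where $L\ge 0$. For probability measures $\mu,\nu$ on $X$ put $d_{\mathcal F}(\mu,\nu)=\sup_{f\in\mathcal F}\{\mathbb E_\mu f-\mathbb E_\nu f\}$. Let $m,k\ge1$, $\xi>0$. A database is $D\in X^m$, with empirical distribution $\hat\mu_D$; two databases are neighboring if they differ in at most one entry. The GAN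 mechanism with $n$ outputs, run on $D$, draws $k$ i.i.d. samples from $D$ (uniformly, with replacement), applies to them a (possibly randomized) training procedure which returns some $g\in\mathcal G$, and outputs $n$ independent samples from $g$. The training procedure has optimization error at most $\tau$: for all training samples, with empirical distribution $\hat\mu_k$, one has $d_{\mathcal F}(\hat\mu_k,g)-\inf_{\nu\in\mathcal G}d_{\mathcal F}(\hat\mu_k,\nu)\le\tau$. Let $$\varepsilon_{\mathcal F}(k,\xi)=\sup_{D\in X^m}2\Big(\inf_{\nu\in\mathcal G}d_{\mathcal F}(\hat\mu_D,\nu)+\tau+\frac{C_\xi}{\sqrt k}\Big),\qquad C_\xi=16\sqrt{2\pi}\,pL+2\Delta\sqrt{2\log(1/\xi)},$$ $$\Delta'=\sup_{f\in\mathcal F}\sup_{x,y\in X}|f(x)-f(y)|,$$ where $C_\xi$ is understood with $\sqrt{2\log(1/\xi)}$ replaced by $0$ if $\xi>1$. Then, with probability at least $1-2\xi$ over the randomness of the training phase (the draws of the training samples), the GAN mechanism generating one sample ($n=1$) from the trained generators has the following property for every $\epsilon\ge0$: it is not $(\epsilon,\delta)$-differentially private for any $$\delta<\frac{e^\epsilon+1}{2\Delta}\Big(\frac{\Delta'}{2m}-\varepsilon_{\mathcal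 F}(k,\xi)\Big)+1-e^\epsilon .$$ In particular, if $0\le\epsilon\le a:=\frac1\Delta\big(\frac{\Delta'}{2m}-\varepsilon_{\mathcal F}(k,\xi)\big)$, it is not $(\epsilon,\delta)$-differentially private for any $\delta<a-\epsilon$. (So, when $\varepsilon_{\mathcal F}(k,\xi)$ is negligible compared with $1/m$ and $\epsilon\le c/m$ with a constant $c<\Delta'/(2\Delta)$, $\delta$ cannot be $o(1/m)$.) -/

import Mathlib

open MeasureTheory ProbabilityTheory

namespace GanPrivacy

noncomputable section

/-- Two databases with `m` entries are neighboring if they differ in at most one entry. -/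
def Neighboring {X : Type*} {m : ℕ} (D₀ D₁ : Fin m → X) : Prop :=
  {i | D₀ i ≠ D₁ i}.ncard ≤ 1

/-- `(ε, δ)`-differential privacy of a mechanism; `M D` is the law of the output on database `D`. -/
def IsDifferentiallyPrivate {X Y : Type*} [MeasurableSpace Y] {m : ℕ}
    (M : (Fin m → X) → Measure Y) (ε δ : ℝ) : Prop :=
  ∀ D₀ D₁ : Fin m → X, Neighboring D₀ D₁ → ∀ S : Set Y, MeasurableSet S →
    (M D₀).real S ≤ Real.exp ε * (M D₁).real S + δ

/-- The empirical distribution (uniform distribution, with multiplicity) of `x₁, …, xₘ`. -/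
def empiricalMeasure {X : Type*} [MeasurableSpace X] {m : ℕ} (D : Fin m → X) : Measure X :=
  (m : ENNReal)⁻¹ • ∑ i, Measure.dirac (D i)

/-- The integral probability metric `d_F(μ, ν) = sup_{f ∈ F} (E_μ f - E_ν f)`. -/
def ipm {X : Type*} [MeasurableSpace X] (F : Set (X → ℝ)) (μ ν : Measure X) : ℝ :=
  ⨆ f : F, ((∫ x, f.1 x ∂μ) - ∫ x, f.1 x ∂ν)

/-- The affine span `{w₀ + ∑ wᵢ fᵢ}` of a set of functions. -/
def spanF {X : Type*} (F : Set (X → ℝ)) : Set (X → ℝ) :=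
  {h | ∃ (n : ℕ) (w₀ : ℝ) (w : Fin n → ℝ) (f : Fin n → X → ℝ),
    (∀ i, f i ∈ F) ∧ h = fun x => w₀ + ∑ i, w i * f i x}

/-- Every generator has a density with respect to `lam`, and the log-ratio of any two of the
densities belongs to the span of the discriminators. `ENNReal.log` takes the values `⊥` at `0` and
`⊤` at `∞`, so the equation with a real number says that the ratio is positive and finite;
it is required where at least one of the two densities is nonzero (up to null sets). -/
def LogRatiosInSpan {X : Type*} [MeasurableSpace X] (lam : Measure X)
    (F : Set (X → ℝ)) (G : Set (ProbabilityMeasure X)) : Prop :=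
  (∀ ν ∈ G, (ν : Measure X) ≪ lam) ∧
  ∀ ν₁ ∈ G, ∀ ν₂ ∈ G, ∃ h ∈ spanF F,
    ∀ᵐ x ∂((ν₁ : Measure X) + (ν₂ : Measure X)),
      ENNReal.log ((ν₁ : Measure X).rnDeriv lam x / (ν₂ : Measure X).rnDeriv lam x)
        = ((h x : ℝ) : EReal)

/-- The set of discriminators is even and uniformly bounded by `Δ`. -/
def EvenBounded {X : Type*} (F : Set (X → ℝ)) (Δ : ℝ) : Prop :=
  (∀ f ∈ F, -f ∈ F) ∧ ∀ f ∈ F, ∀ x, |f x| ≤ Δ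

/-- The parameters lie in `[-1, 1]^p` and the discriminators are `L`-Lipschitz in the parameter,
for the supremum norm on functions and the Euclidean norm on parameters. -/
def LipschitzParametrized {X : Type*} {p : ℕ} (disc : EuclideanSpace ℝ (Fin p) → X → ℝ)
    (Θ : Set (EuclideanSpace ℝ (Fin p))) (L : ℝ) : Prop :=
  (∀ θ ∈ Θ, ∀ i, θ i ∈ Set.Icc (-1 : ℝ) 1) ∧
  ∀ θ ∈ Θ, ∀ θ' ∈ Θ, ∀ x, |disc θ x - disc θ' x| ≤ L * ‖θ - θ'‖

/-- `C_ξ = 16 √(2π) p L + 2 Δ √(2 log (1/ξ))`. -/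
def constC (p : ℕ) (L Δ ξ : ℝ) : ℝ :=
  16 * Real.sqrt (2 * Real.pi) * p * L + 2 * Δ * Real.sqrt (2 * Real.log (1 / ξ))

/-- `inf_{ν ∈ G} d_F(μ, ν)`. -/
def approxError {X : Type*} [MeasurableSpace X] (F : Set (X → ℝ))
    (G : Set (ProbabilityMeasure X)) (μ : Measure X) : ℝ :=
  ⨅ ν : G, ipm F μ (ν.1 : Measure X)

/-- `ε_F(k, ξ, μ) = 2 (inf_{ν ∈ G} d_F(μ, ν) + τ + C_ξ / √k)`, where `μ` is the distribution from
which the `k` training samples are drawn. -/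
def genError {X : Type*} [MeasurableSpace X] (F : Set (X → ℝ)) (G : Set (ProbabilityMeasure X))
    (p : ℕ) (L Δ τ : ℝ) (k : ℕ) (ξ : ℝ) (μ : Measure X) : ℝ :=
  2 * (approxError F G μ + τ + constC p L Δ ξ / Real.sqrt k)

/-- `ε_F(k, ξ)` for databases with `m` entries: the training samples are drawn from the empirical
distribution of the database, and the bound is uniform over the databases. -/
def genErrorUnif {X : Type*} [MeasurableSpace X] (F : Set (X → ℝ))
    (G : Set (ProbabilityMeasure X)) (p : ℕ) (L Δ τ : ℝ) (m k : ℕ) (ξ : ℝ) : ℝ :=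
  ⨆ D : Fin m → X, genError F G p L Δ τ k ξ (empiricalMeasure D)

/-- `Δ' = sup_{f ∈ F} sup_{x, y} |f x - f y|`. -/
def oscillation {X : Type*} (F : Set (X → ℝ)) : ℝ :=
  ⨆ f : F, ⨆ z : X × X, |f.1 z.1 - f.1 z.2|

/-- A (possibly randomized, with internal randomness `s`) training procedure which, from any `k`
training samples, returns a generator in `G` with optimization error at most `τ`. -/
def IsTrainer {X Seed : Type*} [MeasurableSpace X] {k : ℕ} (F : Set (X → ℝ))
    (G : Set (ProbabilityMeasure X)) (τ : ℝ)
    (train : Seed → (Fin k → X) → ProbabilityMeasure X) : Prop :=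
  ∀ s T, train s T ∈ G ∧
    ipm F (empiricalMeasure T) (train s T : Measure X) - approxError F G (empiricalMeasure T) ≤ τ

/-- For every database, the `k` indices of the training samples are i.i.d. uniform on the `m`
entries. The joint law of the draws for different databases is left arbitrary. -/
def IIDUniformDraws {X Ω : Type*} [MeasurableSpace Ω] {m k : ℕ} (P : Measure Ω)
    (idx : (Fin m → X) → Ω → Fin k → Fin m) : Prop :=
  ∀ D, Measurable (idx D) ∧
    P.map (idx D) = Measure.pi (fun _ : Fin k => uniformOn (Set.univ : Set (Fin m)))

/-- The GAN mechanism releasing `n` generated samples, for one outcome `ω` of the randomness of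
training: on database `D` it takes the training samples `D (idx D ω j)`, `j < k`, trains a generator
on them, and outputs `n` independent samples from the trained generator. The value is the law of
the output. -/
def ganMechanism {X Seed Ω : Type*} [MeasurableSpace X] {m k : ℕ}
    (train : Seed → (Fin k → X) → ProbabilityMeasure X)
    (idx : (Fin m → X) → Ω → Fin k → Fin m) (seed : (Fin m → X) → Ω → Seed)
    (n : ℕ) (ω : Ω) (D : Fin m → X) : Measure (Fin n → X) :=
  Measure.pi (fun _ : Fin n => (train (seed D ω) (fun j => D (idx D ω j)) : Measure X))

end

end GanPrivacy

/-!
The mechanism run on a database `D` releases a sample of a generator `g_D`, and `g_D` is close to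
the empirical distribution of `D`: if the training sample is within `C_ξ / √k` of `D` for the metric
`d_F`, the triangle inequality and the optimality of training give `d_F(D, g_D) ≤ ε_F(k, ξ)`
(`ipm_train_le`). Take for `D₀` a constant database and for `D₁` the same database with one entry
changed, the two values being chosen so that some discriminator `f` nearly attains the oscillation
`Δ'`. The means of `f` over `D₀` and `D₁` differ by nearly `Δ' / m`, hence its means under the two
generators differ by nearly `Δ' / m - 2 ε_F(k, ξ)`. Differential privacy, applied to a set and to
its complement with `D₀` and `D₁` exchanged, bounds the total variation distance of the generators
by `(2 δ + e^ε - 1) / (e^ε + 1)`, and so the difference of the means by `2 Δ` times this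
(`integral_sub_le_of_indistinguishable`). Comparing the two bounds gives
`δ ≥ (e^ε + 1) a / 2 - (e^ε - 1) / 2` with `a = (Δ' / (2 m) - ε_F(k, ξ)) / Δ`, which implies both
claims.

The training sample is close to the database with probability at least `1 - ξ`
(`measureReal_sampling_error_le`). Its distance is a supremum over the discriminators of a centered
process with sub-Gaussian increments, so its mean is controlled by chaining along the dyadic cells
of the parameter box (`integral_chaining_le`), and its fluctuation by McDiarmid's inequality
(`hasSubgaussianMGF_of_bounded_differences`). The sample space is finite, so no question of
measurability arises for the supremum.

A single event has to serve for all `δ` below the threshold, although `Δ'` need not be attained. The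
event used is that the training samples are close for infinitely many terms of a sequence of pairs
`(D₀, D₁)` whose gaps approach `Δ'`; its probability is at least `1 - 2 ξ`
(`le_measureReal_frequently`), since each pair has at least this probability of being good.
-/

namespace GanPrivacy

/-! ### Maxima of sub-Gaussian variables and chaining -/

/-- The expected maximum of at most `exp q` sub-Gaussian variables with variance proxy `c` is at
most `√(2 c q)`. The maximum is replaced by an arbitrary random selection `i`, so that suprema need
not be attained and no maximum has to be formed. -/
lemma integral_selection_le {S ι : Type*} [MeasurableSpace S] {P : Measure S}
    [IsProbabilityMeasure P] {I : Finset ι} {Y : ι → S → ℝ} {c : NNReal} {q : ℝ}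
    (hq : 0 ≤ q) (hI : (I.card : ℝ) ≤ Real.exp q)
    (hY : ∀ j ∈ I, HasSubgaussianMGF (Y j) c P) {i : S → ι} (hi : ∀ ω, i ω ∈ I)
    (hint : Integrable (fun ω => Y (i ω) ω) P) :
    ∫ ω, Y (i ω) ω ∂P ≤ √(2 * c * q) := by
  have key : ∀ s : ℝ, 0 < s → ∫ ω, Y (i ω) ω ∂P ≤ q / s + c * s / 2 := by
    intro s hs
    set A : ℝ := q + c * s ^ 2 / 2 with hA
    -- The tangent inequality `u ≤ exp (u - A) + A - 1` takes the place of Jensen's inequality.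
    have h1 : ∀ ω, s * Y (i ω) ω ≤ (∑ j ∈ I, Real.exp (s * Y j ω)) * Real.exp (-A) + (A - 1) := by
      intro ω
      have h2 : Real.exp (s * Y (i ω) ω) ≤ ∑ j ∈ I, Real.exp (s * Y j ω) :=
        Finset.single_le_sum (f := fun j => Real.exp (s * Y j ω))
          (fun j _ => (Real.exp_pos _).le) (hi ω)
      have h3 := Real.add_one_le_exp (s * Y (i ω) ω - A)
      rw [sub_eq_add_neg, Real.exp_add] at h3
      have h4 := mul_le_mul_of_nonneg_right h2 (Real.exp_pos (-A)).le
      linarith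
    have hsum : Integrable (fun ω => ∑ j ∈ I, Real.exp (s * Y j ω)) P :=
      integrable_finsetSum _ fun j hj => (hY j hj).integrable_exp_mul s
    have h5 : ∫ ω, s * Y (i ω) ω ∂P
        ≤ ∫ ω, ((∑ j ∈ I, Real.exp (s * Y j ω)) * Real.exp (-A) + (A - 1)) ∂P :=
      integral_mono (hint.const_mul s) ((hsum.mul_const _).add (integrable_const _)) h1
    rw [integral_const_mul, integral_add (hsum.mul_const _) (integrable_const _),
      integral_mul_const, integral_finsetSum _ fun j hj => (hY j hj).integrable_exp_mul s] at h5
    have h6 : ∑ j ∈ I, ∫ ω, Real.exp (s * Y j ω) ∂P ≤ Real.exp A := by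
      calc ∑ j ∈ I, ∫ ω, Real.exp (s * Y j ω) ∂P
          ≤ ∑ j ∈ I, Real.exp (c * s ^ 2 / 2) := Finset.sum_le_sum fun j hj => (hY j hj).mgf_le s
        _ = I.card * Real.exp (c * s ^ 2 / 2) := by simp
        _ ≤ Real.exp q * Real.exp (c * s ^ 2 / 2) := by gcongr
        _ = Real.exp A := by rw [← Real.exp_add]
    have h7 := mul_le_mul_of_nonneg_right h6 (Real.exp_pos (-A)).le
    rw [← Real.exp_add, add_neg_cancel, Real.exp_zero] at h7
    have h8 : s * ∫ ω, Y (i ω) ω ∂P ≤ A := by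
      simp only [integral_const, probReal_univ, smul_eq_mul, one_mul] at h5
      linarith
    have h9 : q / s + c * s / 2 = A / s := by rw [hA]; field_simp
    rw [h9, le_div_iff₀ hs]
    linarith
  -- The optimal `s = √(2 q / c)` is perturbed, to include the cases `c = 0` and `q = 0`.
  have key2 : ∀ η : ℝ, 0 < η → ∫ ω, Y (i ω) ω ∂P ≤ √((c + η) * (2 * q + η)) := by
    intro η hη
    have hc : (0 : ℝ) < c + η := by positivity
    have hq' : 0 < 2 * q + η := by positivity
    refine (key (√(2 * q + η) / √(c + η)) (by positivity)).trans ?_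
    rw [Real.sqrt_mul hc.le]
    have e1 := Real.sq_sqrt hc.le
    have e2 := Real.sq_sqrt hq'.le
    set u := √((c : ℝ) + η)
    set v := √(2 * q + η)
    have hu : 0 < u := Real.sqrt_pos.2 hc
    have hv : 0 < v := Real.sqrt_pos.2 hq'
    have hq2 : q ≤ v ^ 2 / 2 := by linarith
    have hc2 : (c : ℝ) ≤ u ^ 2 := by linarith
    calc q / (v / u) + c * (v / u) / 2
        ≤ (v ^ 2 / 2) / (v / u) + u ^ 2 * (v / u) / 2 := by gcongr
      _ = u * v := by field_simp; ring
  have hlim : Filter.Tendsto (fun η : ℝ => √((c + η) * (2 * q + η))) (nhdsWithin 0 (Set.Ioi 0))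
      (nhds √((c + 0) * (2 * q + 0))) := by
    refine Filter.Tendsto.mono_left (Continuous.tendsto ?_ 0) nhdsWithin_le_nhds
    fun_prop
  have h10 := ge_of_tendsto hlim (Filter.eventually_of_mem self_mem_nhdsWithin key2)
  refine h10.trans_eq ?_
  congr 1; ring

/-- The dyadic cell of generation `j` of a point of the box `[-1, 1]^p`. The cells have side
`4 / 2 ^ j`, so that the whole box, with its upper boundary, lies in one cell of generation `0`. -/
noncomputable def cell {p : ℕ} (j : ℕ) (x : EuclideanSpace ℝ (Fin p)) : Fin p → ℕ :=
  fun i => ⌊(x i + 1) / 4 * 2 ^ j⌋₊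

lemma cell_succ_div_two {p : ℕ} (j : ℕ) (x : EuclideanSpace ℝ (Fin p)) :
    (fun i => cell (j + 1) x i / 2) = cell j x := by
  funext i
  simp only [cell]
  rw [← Nat.floor_div_natCast]
  congr 1
  push_cast
  ring

lemma cell_mem {p : ℕ} (j : ℕ) {x : EuclideanSpace ℝ (Fin p)}
    (hx : ∀ i, x i ∈ Set.Icc (-1 : ℝ) 1) :
    cell j x ∈ Fintype.piFinset fun _ : Fin p => Finset.range (2 ^ j) := by
  rw [Fintype.mem_piFinset]
  intro i
  have h := hx i
  have h2 : (0 : ℝ) < 2 ^ j := by positivity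
  rw [Finset.mem_range, cell, Nat.floor_lt (mul_nonneg (by linarith [h.1]) h2.le)]
  push_cast
  nlinarith [h.2]

lemma norm_sub_le_of_cell_eq {p : ℕ} {j : ℕ} {x y : EuclideanSpace ℝ (Fin p)}
    (hx : ∀ i, x i ∈ Set.Icc (-1 : ℝ) 1) (hy : ∀ i, y i ∈ Set.Icc (-1 : ℝ) 1)
    (h : cell j x = cell j y) : ‖x - y‖ ≤ 4 * √p * (1 / 2) ^ j := by
  have h2 : (0 : ℝ) < 2 ^ j := by positivity
  have hi : ∀ i, ‖(x - y) i‖ ^ 2 ≤ (4 * (1 / 2) ^ j) ^ 2 := by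
    intro i
    have hc : ⌊(x i + 1) / 4 * 2 ^ j⌋₊ = ⌊(y i + 1) / 4 * 2 ^ j⌋₊ := congrFun h i
    have hx0 : 0 ≤ (x i + 1) / 4 * 2 ^ j := mul_nonneg (by linarith [(hx i).1]) h2.le
    have hy0 : 0 ≤ (y i + 1) / 4 * 2 ^ j := mul_nonneg (by linarith [(hy i).1]) h2.le
    have a1 := Nat.floor_le hx0
    have a2 := Nat.lt_floor_add_one ((x i + 1) / 4 * 2 ^ j)
    have b1 := Nat.floor_le hy0
    have b2 := Nat.lt_floor_add_one ((y i + 1) / 4 * 2 ^ j)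
    rw [hc] at a1 a2
    have e : (4 * (1 / 2) ^ j : ℝ) = 4 / 2 ^ j := by rw [one_div, inv_pow]; rfl
    refine pow_le_pow_left₀ (norm_nonneg _) ?_ 2
    rw [e, Real.norm_eq_abs, PiLp.sub_apply, le_div_iff₀ h2,
      show |x i - y i| * 2 ^ j = |(x i - y i) * 2 ^ j| by
        rw [abs_mul, abs_of_pos h2], abs_le]
    constructor <;> nlinarith
  rw [EuclideanSpace.norm_eq]
  calc √(∑ i, ‖(x - y) i‖ ^ 2) ≤ √(∑ _i : Fin p, (4 * (1 / 2) ^ j) ^ 2) :=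
        Real.sqrt_le_sqrt (Finset.sum_le_sum fun i _ => hi i)
    _ = 4 * √p * (1 / 2) ^ j := by
        rw [Finset.sum_const, Finset.card_univ, Fintype.card_fin, nsmul_eq_mul,
          Real.sqrt_mul (by positivity), Real.sqrt_sq (by positivity)]
        ring

/-- A point of `Θ` in the same dyadic cell of generation `j` as a given point of `Θ`; it depends on
the cell only. -/
lemma exists_cell_representative {p : ℕ} {Θ : Set (EuclideanSpace ℝ (Fin p))}
    (hΘ : Θ.Nonempty) (j : ℕ) :
    ∃ r : (Fin p → ℕ) → EuclideanSpace ℝ (Fin p),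
      (∀ c, r c ∈ Θ) ∧ ∀ θ ∈ Θ, cell j (r (cell j θ)) = cell j θ := by
  have : ∀ c : Fin p → ℕ, ∃ y ∈ Θ, (∃ θ ∈ Θ, cell j θ = c) → cell j y = c := by
    intro c
    by_cases h : ∃ θ ∈ Θ, cell j θ = c
    · obtain ⟨θ, h1, h2⟩ := h
      exact ⟨θ, h1, fun _ => h2⟩
    · exact ⟨hΘ.some, hΘ.some_mem, fun h' => absurd h' h⟩
  choose r h1 h2 using this
  exact ⟨r, h1, fun θ hθ => h2 _ ⟨θ, hθ, rfl⟩⟩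

lemma sum_dyadic_weights_le (J : ℕ) :
    ∑ j ∈ Finset.range J, (1 / 2 : ℝ) ^ j * ((j + 3) / 2) ≤ 4 := by
  have h : ∑ j ∈ Finset.range J, (1 / 2 : ℝ) ^ j * ((j + 3) / 2)
      = 4 - (1 / 2) ^ J * (J + 4) := by
    induction J with
    | zero => norm_num
    | succ n ih => rw [Finset.sum_range_succ, ih, pow_succ]; push_cast; ring
  rw [h]
  have : (0 : ℝ) ≤ (1 / 2) ^ J * (J + 4) := by positivity
  linarith

/-- Chaining: a centered process on `Θ ⊆ [-1, 1]^p` whose increments are sub-Gaussian for the metric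
`σ ‖θ - θ'‖` has expected supremum at most `16 σ p`. The supremum is again expressed by an arbitrary
random selection `θ`, and the pathwise Lipschitz bound, whose constant does not enter the result,
removes the tail of the chain. -/
theorem integral_chaining_le {S : Type*} [Finite S] [MeasurableSpace S] [DiscreteMeasurableSpace S]
    {P : Measure S} [IsProbabilityMeasure P] {p : ℕ} {Θ : Set (EuclideanSpace ℝ (Fin p))}
    (hΘ : Θ.Nonempty) (hbox : ∀ θ ∈ Θ, ∀ i, θ i ∈ Set.Icc (-1 : ℝ) 1)
    {Z : EuclideanSpace ℝ (Fin p) → S → ℝ} {σ : NNReal} {K : ℝ} (hK : 0 ≤ K)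
    (hmean : ∀ θ ∈ Θ, ∫ ω, Z θ ω ∂P = 0)
    (hsub : ∀ θ ∈ Θ, ∀ θ' ∈ Θ, ∀ r : NNReal, ‖θ - θ'‖ ≤ r →
      HasSubgaussianMGF (fun ω => Z θ ω - Z θ' ω) ((σ * r) ^ 2) P)
    (hlip : ∀ θ ∈ Θ, ∀ θ' ∈ Θ, ∀ ω, Z θ ω - Z θ' ω ≤ K * ‖θ - θ'‖)
    (θ : S → EuclideanSpace ℝ (Fin p)) (hθ : ∀ ω, θ ω ∈ Θ) :
    ∫ ω, Z (θ ω) ω ∂P ≤ 16 * σ * p := by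
  choose r hr hcell using exists_cell_representative hΘ
  set π : ℕ → EuclideanSpace ℝ (Fin p) → EuclideanSpace ℝ (Fin p) := fun j x => r j (cell j x)
    with hπ
  have hint : ∀ V : S → ℝ, Integrable V P := fun V => .of_finite
  have hstep : ∀ j : ℕ, ∫ ω, (Z (π (j + 1) (θ ω)) ω - Z (π j (θ ω)) ω) ∂P
      ≤ 4 * σ * p * ((1 / 2) ^ j * ((j + 3) / 2)) := by
    intro j
    classical
    set I : Finset (Fin p → ℕ) :=
      (Fintype.piFinset fun _ : Fin p => Finset.range (2 ^ (j + 1))).filter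
        fun c => ∃ x ∈ Θ, cell (j + 1) x = c with hI
    set R : NNReal := 4 * NNReal.sqrt p * (1 / 2) ^ j with hR
    have hRr : (R : ℝ) = 4 * √p * (1 / 2) ^ j := by simp [hR]
    have hcard : (I.card : ℝ) ≤ Real.exp ((j + 1) * p) := by
      have h1 : I.card ≤ 2 ^ ((j + 1) * p) := by
        refine (Finset.card_filter_le _ _).trans_eq ?_
        simp [pow_mul]
      calc (I.card : ℝ) ≤ 2 ^ ((j + 1) * p) := by exact_mod_cast h1
        _ ≤ (Real.exp 1) ^ ((j + 1) * p) := by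
            gcongr
            linarith [Real.add_one_le_exp (1 : ℝ)]
        _ = Real.exp ((j + 1) * p) := by
            rw [← Real.exp_nat_mul]; push_cast; ring_nf
    have hsubI : ∀ c ∈ I, HasSubgaussianMGF
        (fun ω => Z (r (j + 1) c) ω - Z (r j (fun i => c i / 2)) ω) ((σ * R) ^ 2) P := by
      intro c hc
      obtain ⟨x, hx, rfl⟩ := (Finset.mem_filter.1 hc).2
      refine hsub _ (hr _ _) _ (hr _ _) R ?_
      rw [hRr]
      refine norm_sub_le_of_cell_eq (hbox _ (hr _ _)) (hbox _ (hr _ _)) ?_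
      rw [cell_succ_div_two, hcell j x hx, ← cell_succ_div_two, hcell (j + 1) x hx,
        cell_succ_div_two]
    have h := integral_selection_le (P := P) (q := (j + 1) * p) (by positivity) hcard hsubI
      (i := fun ω => cell (j + 1) (θ ω))
      (fun ω => Finset.mem_filter.2 ⟨cell_mem _ (hbox _ (hθ ω)), θ ω, hθ ω, rfl⟩) (hint _)
    simp only [cell_succ_div_two] at h
    refine h.trans (Real.sqrt_le_iff.2 ⟨by positivity, ?_⟩)
    push_cast
    rw [hRr]
    have hp : √(p : ℝ) ^ 2 = p := Real.sq_sqrt (by positivity)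
    have e1 : 2 * ((σ : ℝ) * (4 * √p * (1 / 2) ^ j)) ^ 2 * ((j + 1) * p)
        = (4 * σ * p * (1 / 2) ^ j) ^ 2 * (2 * (j + 1)) := by
      rw [show ((σ : ℝ) * (4 * √p * (1 / 2) ^ j)) ^ 2
        = (σ * 4 * (1 / 2) ^ j) ^ 2 * √(p : ℝ) ^ 2 by ring, hp]
      ring
    rw [e1, ← mul_assoc (4 * (σ : ℝ) * p), mul_pow (4 * (σ : ℝ) * p * (1 / 2) ^ j)]
    gcongr
    -- `√(2 (j + 1)) ≤ (j + 3) / 2`, the arithmetic-geometric mean inequality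
    nlinarith [sq_nonneg ((j : ℝ) - 1)]
  have hJ : ∀ J : ℕ, ∫ ω, Z (θ ω) ω ∂P ≤ 16 * σ * p + K * (4 * √p * (1 / 2) ^ J) := by
    intro J
    have h0 : ∀ ω, Z (π 0 (θ ω)) ω = Z (r 0 0) ω := by
      intro ω
      have : cell 0 (θ ω) = 0 := by
        have := cell_mem 0 (hbox _ (hθ ω))
        funext i
        simpa using Fintype.mem_piFinset.1 this i
      simp only [hπ, this]
    have h1 : ∀ ω, Z (θ ω) ω ≤ Z (r 0 0) ω
        + ∑ j ∈ Finset.range J, (Z (π (j + 1) (θ ω)) ω - Z (π j (θ ω)) ω)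
        + K * (4 * √p * (1 / 2) ^ J) := by
      intro ω
      rw [Finset.sum_range_sub (fun j => Z (π j (θ ω)) ω), h0]
      have h2 := hlip _ (hθ ω) (π J (θ ω)) (hr _ _) ω
      have h3 := mul_le_mul_of_nonneg_left (norm_sub_le_of_cell_eq (j := J)
        (hbox _ (hθ ω)) (hbox (π J (θ ω)) (hr _ _)) (hcell J _ (hθ ω)).symm) hK
      linarith
    have h2 := integral_mono (hint _) (hint _) h1
    rw [integral_add (hint _) (hint _), integral_add (hint _) (hint _),
      integral_finsetSum _ (fun _ _ => hint _), hmean _ (hr _ _)] at h2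
    have h3 : ∑ j ∈ Finset.range J, ∫ ω, (Z (π (j + 1) (θ ω)) ω - Z (π j (θ ω)) ω) ∂P
        ≤ 16 * σ * p := by
      refine (Finset.sum_le_sum fun j _ => hstep j).trans ?_
      rw [← Finset.mul_sum]
      calc 4 * (σ : ℝ) * p * ∑ j ∈ Finset.range J, (1 / 2 : ℝ) ^ j * ((j + 3) / 2)
          ≤ 4 * σ * p * 4 := by gcongr; exact sum_dyadic_weights_le J
        _ = 16 * σ * p := by ring
    simp only [integral_const, probReal_univ, smul_eq_mul, one_mul] at h2
    linarith
  have hlim : Filter.Tendsto (fun J : ℕ => 16 * (σ : ℝ) * p + K * (4 * √p * (1 / 2) ^ J))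
      Filter.atTop (nhds (16 * σ * p + K * (4 * √p * 0))) :=
    ((((tendsto_pow_atTop_nhds_zero_of_lt_one (by norm_num) (by norm_num)).const_mul _).const_mul
      _).const_add _)
  have := ge_of_tendsto' hlim hJ
  simpa using this

/-! ### The bounded differences inequality -/

/-- McDiarmid's inequality, in terms of the moment generating function, on a finite product space:
a function which changes by at most `c` when one coordinate is changed is sub-Gaussian, after
centering, with variance proxy `k (c / 2)²`. -/
theorem hasSubgaussianMGF_of_bounded_differences {α : Type*} [Finite α] [MeasurableSpace α]
    [DiscreteMeasurableSpace α] (μ : Measure α) [IsProbabilityMeasure μ] (c : NNReal) (k : ℕ)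
    (f : (Fin k → α) → ℝ) (hf : ∀ y i a, |f (Function.update y i a) - f y| ≤ c) :
    HasSubgaussianMGF (fun y => f y - ∫ z, f z ∂Measure.pi fun _ => μ) (k * (c / 2) ^ 2)
      (Measure.pi fun _ : Fin k => μ) := by
  refine ⟨fun t => .of_finite, ?_⟩
  induction k with
  | zero =>
    intro t
    have h : ∀ y : Fin 0 → α, f y = f default := fun y => by rw [Subsingleton.elim y default]
    simp [mgf, h]
  | succ k ih =>
    intro t
    have hint : ∀ {β : Type _} [Finite β] [MeasurableSpace β] [DiscreteMeasurableSpace β]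
      (ν : Measure β) [IsFiniteMeasure ν] (V : β → ℝ), Integrable V ν := fun ν _ V => .of_finite
    set g : α → ℝ := fun a => ∫ y, f (Fin.cons a y) ∂Measure.pi fun _ => μ with hg
    have hpi : ∀ V : (Fin (k + 1) → α) → ℝ, ∫ z, V z ∂(Measure.pi fun _ => μ)
        = ∫ a, ∫ y, V (Fin.cons a y) ∂(Measure.pi fun _ => μ) ∂μ := by
      intro V
      have h := (measurePreserving_piFinSuccAbove (fun _ : Fin (k + 1) => μ) 0).symm
      rw [← h.integral_comp' (g := V), integral_prod _ .of_finite]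
      simp [MeasurableEquiv.piFinSuccAbove, Fin.insertNthEquiv]
    have hne : Nonempty α := nonempty_of_isProbabilityMeasure μ
    have hgc : ∀ a b, g a ≤ g b + c := by
      intro a b
      have h1 : ∀ y, f (Fin.cons a y) ≤ f (Fin.cons b y) + c := by
        intro y
        have := (abs_le.1 (hf (Fin.cons b y) 0 a)).2
        rw [Fin.update_cons_zero] at this
        linarith
      have h2 := integral_mono (hint (Measure.pi fun _ : Fin k => μ) _)
        (hint (Measure.pi fun _ : Fin k => μ) _) h1
      rw [integral_add (hint _ _) (hint _ _)] at h2
      simpa using h2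
    have hh : HasSubgaussianMGF (fun a => g a - ∫ b, g b ∂μ) ((c / 2) ^ 2) μ := by
      obtain ⟨b, hb⟩ := Finite.exists_min g
      have := hasSubgaussianMGF_of_mem_Icc (μ := μ) (X := g) (a := g b) (b := g b + c)
        (Measurable.of_discrete).aemeasurable (ae_of_all _ fun a => ⟨hb a, hgc a b⟩)
      simpa using this
    have hinner : ∀ a, ∫ y, Real.exp (t * (f (Fin.cons a y) - g a)) ∂(Measure.pi fun _ => μ)
        ≤ Real.exp ((k * (c / 2) ^ 2 : NNReal) * t ^ 2 / 2) := by
      intro a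
      refine ih (fun y => f (Fin.cons a y)) (fun y i x => ?_) t
      rw [Fin.cons_update]
      exact hf _ _ _
    have hE : ∫ z, f z ∂(Measure.pi fun _ => μ) = ∫ b, g b ∂μ := hpi f
    rw [mgf, hpi, hE]
    calc ∫ a, ∫ y, Real.exp (t * (f (Fin.cons a y) - ∫ b, g b ∂μ)) ∂(Measure.pi fun _ => μ) ∂μ
        = ∫ a, Real.exp (t * (g a - ∫ b, g b ∂μ)) *
            ∫ y, Real.exp (t * (f (Fin.cons a y) - g a)) ∂(Measure.pi fun _ => μ) ∂μ := by
          congr 1; funext a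
          rw [← integral_const_mul]
          congr 1; funext y
          rw [← Real.exp_add]
          ring_nf
      _ ≤ ∫ a, Real.exp (t * (g a - ∫ b, g b ∂μ)) *
            Real.exp ((k * (c / 2) ^ 2 : NNReal) * t ^ 2 / 2) ∂μ := by
          refine integral_mono (hint _ _) (hint _ _) fun a => ?_
          exact mul_le_mul_of_nonneg_left (hinner a) (Real.exp_pos _).le
      _ ≤ Real.exp (((c / 2) ^ 2 : NNReal) * t ^ 2 / 2) *
            Real.exp ((k * (c / 2) ^ 2 : NNReal) * t ^ 2 / 2) := by
          rw [integral_mul_const]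
          exact mul_le_mul_of_nonneg_right (hh.mgf_le t) (Real.exp_pos _).le
      _ = Real.exp (((k + 1 : ℕ) * (c / 2) ^ 2 : NNReal) * t ^ 2 / 2) := by
          rw [← Real.exp_add]
          congr 1
          push_cast
          ring

/-! ### Empirical measures and the integral probability metric -/

lemma isProbabilityMeasure_empiricalMeasure {X : Type*} [MeasurableSpace X] {m : ℕ} (hm : 0 < m)
    (D : Fin m → X) : IsProbabilityMeasure (empiricalMeasure D) := by
  constructor
  have hm' : (m : ENNReal) ≠ 0 := by exact_mod_cast hm.ne'
  simp [empiricalMeasure, ENNReal.inv_mul_cancel hm' (ENNReal.natCast_ne_top m)]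

lemma integral_empiricalMeasure {X : Type*} [MeasurableSpace X] {m : ℕ} (D : Fin m → X)
    {f : X → ℝ} (hf : Measurable f) :
    ∫ x, f x ∂empiricalMeasure D = (∑ i, f (D i)) / m := by
  have hd : ∀ i ∈ (Finset.univ : Finset (Fin m)), Integrable f (Measure.dirac (D i)) := fun i _ =>
    integrable_dirac' hf.stronglyMeasurable (by simp)
  rw [empiricalMeasure, integral_smul_measure, integral_finsetSum_measure hd]
  simp only [integral_dirac' f _ hf.stronglyMeasurable, ENNReal.toReal_inv, ENNReal.toReal_natCast,
    smul_eq_mul]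
  rw [div_eq_inv_mul]

lemma integral_uniformOn_univ {m : ℕ} [NeZero m] (h : Fin m → ℝ) :
    ∫ i, h i ∂uniformOn (Set.univ : Set (Fin m)) = (∑ i, h i) / m := by
  have := isProbabilityMeasure_uniformOn (Set.finite_univ (α := Fin m)) Set.univ_nonempty
  rw [integral_fintype .of_finite, div_eq_inv_mul, Finset.mul_sum]
  refine Finset.sum_congr rfl fun i _ => ?_
  simp [Measure.real, uniformOn_univ]

section IPM

variable {X : Type*} [MeasurableSpace X] {F : Set (X → ℝ)} {Δ : ℝ}

lemma abs_integral_le_of_bounded (hF : EvenBounded F Δ) {f : X → ℝ} (hf : f ∈ F) (μ : Measure X)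
    [IsProbabilityMeasure μ] : |∫ x, f x ∂μ| ≤ Δ := by
  have := norm_integral_le_of_norm_le_const (μ := μ) (f := f) (C := Δ)
    (ae_of_all _ fun x => hF.2 f hf x)
  simpa using this

lemma bddAbove_ipm (hF : EvenBounded F Δ) (μ ν : Measure X) [IsProbabilityMeasure μ]
    [IsProbabilityMeasure ν] :
    BddAbove (Set.range fun f : F => (∫ x, f.1 x ∂μ) - ∫ x, f.1 x ∂ν) := by
  refine ⟨2 * Δ, ?_⟩
  rintro _ ⟨f, rfl⟩
  have h1 := (abs_le.1 (abs_integral_le_of_bounded hF f.2 μ)).2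
  have h2 := (abs_le.1 (abs_integral_le_of_bounded hF f.2 ν)).1
  dsimp only
  linarith

lemma sub_le_ipm (hF : EvenBounded F Δ) {f : X → ℝ} (hf : f ∈ F) (μ ν : Measure X)
    [IsProbabilityMeasure μ] [IsProbabilityMeasure ν] :
    (∫ x, f x ∂μ) - ∫ x, f x ∂ν ≤ ipm F μ ν :=
  le_ciSup (bddAbove_ipm hF μ ν) ⟨f, hf⟩

lemma ipm_le (hne : F.Nonempty) {μ ν : Measure X} {c : ℝ}
    (h : ∀ f ∈ F, (∫ x, f x ∂μ) - ∫ x, f x ∂ν ≤ c) : ipm F μ ν ≤ c := by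
  have := hne.to_subtype
  exact ciSup_le fun f => h f.1 f.2

lemma ipm_le_two_mul (hne : F.Nonempty) (hF : EvenBounded F Δ) (μ ν : Measure X)
    [IsProbabilityMeasure μ] [IsProbabilityMeasure ν] : ipm F μ ν ≤ 2 * Δ := by
  refine ipm_le hne fun f hf => ?_
  have h1 := (abs_le.1 (abs_integral_le_of_bounded hF hf μ)).2
  have h2 := (abs_le.1 (abs_integral_le_of_bounded hF hf ν)).1
  linarith

lemma sub_le_ipm_swap (hF : EvenBounded F Δ) {f : X → ℝ} (hf : f ∈ F) (μ ν : Measure X)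
    [IsProbabilityMeasure μ] [IsProbabilityMeasure ν] :
    (∫ x, f x ∂ν) - ∫ x, f x ∂μ ≤ ipm F μ ν := by
  have := sub_le_ipm hF (hF.1 f hf) μ ν
  simp only [Pi.neg_apply, integral_neg] at this
  linarith

lemma ipm_comm (hne : F.Nonempty) (hF : EvenBounded F Δ) (μ ν : Measure X)
    [IsProbabilityMeasure μ] [IsProbabilityMeasure ν] : ipm F μ ν = ipm F ν μ :=
  le_antisymm (ipm_le hne fun _ hf => sub_le_ipm_swap hF hf ν μ)
    (ipm_le hne fun _ hf => sub_le_ipm_swap hF hf μ ν)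

lemma ipm_nonneg (hne : F.Nonempty) (hF : EvenBounded F Δ) (μ ν : Measure X)
    [IsProbabilityMeasure μ] [IsProbabilityMeasure ν] : 0 ≤ ipm F μ ν := by
  obtain ⟨f, hf⟩ := hne
  have h1 := sub_le_ipm hF hf μ ν
  have h2 := sub_le_ipm_swap hF hf μ ν
  linarith

lemma ipm_triangle (hne : F.Nonempty) (hF : EvenBounded F Δ) (μ ν κ : Measure X)
    [IsProbabilityMeasure μ] [IsProbabilityMeasure ν] [IsProbabilityMeasure κ] :
    ipm F μ κ ≤ ipm F μ ν + ipm F ν κ := by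
  refine ipm_le hne fun f hf => ?_
  have h1 := sub_le_ipm hF hf μ ν
  have h2 := sub_le_ipm hF hf ν κ
  linarith

variable {G : Set (ProbabilityMeasure X)}

lemma bddBelow_approxError (hne : F.Nonempty) (hF : EvenBounded F Δ) (μ : Measure X)
    [IsProbabilityMeasure μ] : BddBelow (Set.range fun ν : G => ipm F μ (ν.1 : Measure X)) := by
  refine ⟨0, ?_⟩
  rintro _ ⟨ν, rfl⟩
  exact ipm_nonneg hne hF _ _

lemma approxError_nonneg (hne : F.Nonempty) (hF : EvenBounded F Δ) (μ : Measure X)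
    [IsProbabilityMeasure μ] : 0 ≤ approxError F G μ :=
  Real.iInf_nonneg fun _ => ipm_nonneg hne hF _ _

lemma approxError_le_ipm (hne : F.Nonempty) (hF : EvenBounded F Δ) {g : ProbabilityMeasure X}
    (hg : g ∈ G) (μ : Measure X) [IsProbabilityMeasure μ] :
    approxError F G μ ≤ ipm F μ (g : Measure X) :=
  ciInf_le (bddBelow_approxError hne hF μ) (⟨g, hg⟩ : G)

lemma approxError_le_add (hne : F.Nonempty) (hF : EvenBounded F Δ) (hG : G.Nonempty)
    (μ ν : Measure X) [IsProbabilityMeasure μ] [IsProbabilityMeasure ν] :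
    approxError F G μ ≤ ipm F μ ν + approxError F G ν := by
  have := hG.to_subtype
  rw [← sub_le_iff_le_add']
  refine le_ciInf fun g => ?_
  have h1 := approxError_le_ipm hne hF g.2 μ
  have h2 := ipm_triangle hne hF μ ν (g.1 : Measure X)
  linarith

/-- Changing one of `k` sample points moves the empirical distribution by at most `2 Δ / k`. -/
lemma ipm_empiricalMeasure_update_le (hne : F.Nonempty) (hF : EvenBounded F Δ)
    (hmeas : ∀ f ∈ F, Measurable f) {k : ℕ} (T : Fin k → X) (i : Fin k) (x : X) :
    ipm F (empiricalMeasure (Function.update T i x)) (empiricalMeasure T) ≤ 2 * Δ / k := by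
  refine ipm_le hne fun f hf => ?_
  rw [integral_empiricalMeasure _ (hmeas f hf), integral_empiricalMeasure _ (hmeas f hf),
    ← sub_div, ← Finset.sum_sub_distrib, Finset.sum_eq_single i]
  · rw [Function.update_self]
    have h1 := (abs_le.1 (hF.2 f hf x)).2
    have h2 := (abs_le.1 (hF.2 f hf (T i))).1
    gcongr
    linarith
  · intro j _ hj
    rw [Function.update_of_ne hj, sub_self]
  · simp

end IPM

/-! ### Sampling error of the training set -/

lemma hasSubgaussianMGF_mean_sub_average {α : Type*} [Finite α] [MeasurableSpace α]
    [DiscreteMeasurableSpace α] (μ : Measure α) [IsProbabilityMeasure μ] {k : ℕ}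
    (hk : 0 < k) {h : α → ℝ} {r : NNReal} (hr : ∀ a, |h a| ≤ r) :
    HasSubgaussianMGF (fun y : Fin k → α => ∫ a, h a ∂μ - (∑ j, h (y j)) / k) (r ^ 2 / k)
      (Measure.pi fun _ => μ) := by
  have hk0 : (0 : ℝ) < k := by positivity
  have h1 : HasSubgaussianMGF (fun a => -h a / k + (∫ b, h b ∂μ) / k) ((r / k) ^ 2) μ := by
    have h2 := hasSubgaussianMGF_of_mem_Icc (μ := μ) (X := fun a => -h a / k)
      (a := -(r / k : NNReal)) (b := (r / k : NNReal))
      (Measurable.of_discrete).aemeasurable (ae_of_all _ fun a => by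
        rw [Set.mem_Icc, ← abs_le, abs_div, abs_neg, abs_of_pos hk0]
        push_cast
        gcongr
        exact hr a)
    have e : ‖((r / k : NNReal) : ℝ) - -(r / k : NNReal)‖₊ / 2 = r / k := by
      ext
      rw [NNReal.coe_div, coe_nnnorm, sub_neg_eq_add, Real.norm_of_nonneg (by positivity)]
      push_cast
      ring
    rw [e] at h2
    simp only [integral_div, integral_neg, neg_div, sub_neg_eq_add] at h2
    simpa only [neg_div] using h2
  have h3 : ∀ j : Fin k, HasSubgaussianMGF
      (fun y : Fin k → α => -h (y j) / k + (∫ b, h b ∂μ) / k) ((r / k) ^ 2)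
      (Measure.pi fun _ => μ) := by
    intro j
    have he := measurePreserving_eval (fun _ : Fin k => μ) j
    rw [← he.map_eq] at h1
    have := HasSubgaussianMGF.of_map (Y := Function.eval j) he.aemeasurable h1
    rwa [he.map_eq] at this
  have h4 := HasSubgaussianMGF.sum_of_iIndepFun (s := Finset.univ)
    (iIndepFun_pi (μ := fun _ : Fin k => μ)
      (X := fun _ a => -h a / k + (∫ b, h b ∂μ) / k)
      fun _ => (Measurable.of_discrete).aemeasurable) (fun j _ => h3 j)
  convert h4 using 1
  · funext y
    rw [Finset.sum_add_distrib, ← Finset.sum_div, Finset.sum_neg_distrib]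
    simp only [Finset.sum_const, Finset.card_univ, Fintype.card_fin, nsmul_eq_mul]
    field_simp
    ring
  · simp only [Finset.sum_const, Finset.card_univ, Fintype.card_fin, nsmul_eq_mul]
    have hk'' : (k : NNReal) ≠ 0 := by exact_mod_cast hk.ne'
    field_simp

section Sampling

variable {X : Type*} [MeasurableSpace X] {F : Set (X → ℝ)} {Δ L : ℝ} {p m k : ℕ}
  {disc : EuclideanSpace ℝ (Fin p) → X → ℝ} {Θ : Set (EuclideanSpace ℝ (Fin p))}

/-- The expected distance of a sample of size `k` to the database it is drawn from, by chaining
over the parameters of the discriminators. -/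
lemma integral_ipm_empiricalMeasure_le (hF : F = disc '' Θ) (hΘ : Θ.Nonempty)
    (hmeas : ∀ f ∈ F, Measurable f) (hL : 0 ≤ L)
    (hA3 : LipschitzParametrized disc Θ L) (hm : 0 < m) (hk : 0 < k) (D : Fin m → X) :
    ∫ y, ipm F (empiricalMeasure D) (empiricalMeasure fun j => D (y j))
      ∂(Measure.pi fun _ : Fin k => uniformOn (Set.univ : Set (Fin m))) ≤ 16 * p * L / √k := by
  have : NeZero m := ⟨hm.ne'⟩
  have := isProbabilityMeasure_uniformOn (Set.finite_univ (α := Fin m)) Set.univ_nonempty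
  have := isProbabilityMeasure_empiricalMeasure hm D
  have : ∀ y : Fin k → Fin m, IsProbabilityMeasure (empiricalMeasure fun j => D (y j)) :=
    fun y => isProbabilityMeasure_empiricalMeasure hk _
  set U := uniformOn (Set.univ : Set (Fin m)) with hU
  have hmeasΘ : ∀ θ ∈ Θ, Measurable (disc θ) := fun θ hθ => hmeas _ (hF ▸ ⟨θ, hθ, rfl⟩)
  set Z : EuclideanSpace ℝ (Fin p) → (Fin k → Fin m) → ℝ := fun θ y =>
    (∫ i, disc θ (D i) ∂U) - (∑ j, disc θ (D (y j))) / k with hZ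
  have hZ' : ∀ θ ∈ Θ, ∀ y, (∫ x, disc θ x ∂empiricalMeasure D)
      - ∫ x, disc θ x ∂(empiricalMeasure fun j => D (y j)) = Z θ y := by
    intro θ hθ y
    rw [integral_empiricalMeasure _ (hmeasΘ θ hθ), integral_empiricalMeasure _ (hmeasΘ θ hθ),
      ← integral_uniformOn_univ]
  have hint : ∀ V : (Fin k → Fin m) → ℝ, Integrable V (Measure.pi fun _ : Fin k => U) :=
    fun V => .of_finite
  have hk0 : (0 : ℝ) < k := by positivity
  have hmean : ∀ θ ∈ Θ, ∫ y, Z θ y ∂(Measure.pi fun _ : Fin k => U) = 0 := by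
    intro θ hθ
    have h1 : ∀ j : Fin k, ∫ y : Fin k → Fin m, disc θ (D (y j)) ∂(Measure.pi fun _ => U)
        = ∫ i, disc θ (D i) ∂U := fun j =>
      integral_comp_eval (μ := fun _ : Fin k => U) (i := j) (f := fun i => disc θ (D i))
        (Measurable.of_discrete).aestronglyMeasurable
    rw [hZ, integral_sub (hint _) (hint _), integral_div, integral_finsetSum _ fun _ _ => hint _]
    simp only [h1, integral_const, probReal_univ, one_smul, Finset.sum_const, Finset.card_univ,
      Fintype.card_fin, nsmul_eq_mul]
    field_simp
    ring
  have hsub : ∀ θ ∈ Θ, ∀ θ' ∈ Θ, ∀ r : NNReal, ‖θ - θ'‖ ≤ r →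
      HasSubgaussianMGF (fun y => Z θ y - Z θ' y) ((L.toNNReal / NNReal.sqrt k * r) ^ 2)
        (Measure.pi fun _ : Fin k => U) := by
    intro θ hθ θ' hθ' r hr
    have h1 : ∀ i, |disc θ (D i) - disc θ' (D i)| ≤ (L.toNNReal * r : NNReal) := by
      intro i
      refine (hA3.2 θ hθ θ' hθ' (D i)).trans ?_
      rw [NNReal.coe_mul, Real.coe_toNNReal L hL]
      gcongr
    have h2 := hasSubgaussianMGF_mean_sub_average U hk h1
    convert h2 using 1
    · funext y
      rw [hZ, integral_sub .of_finite .of_finite, Finset.sum_sub_distrib]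
      ring
    · rw [mul_pow, div_pow, NNReal.sq_sqrt, mul_pow]
      ring
  have hlip : ∀ θ ∈ Θ, ∀ θ' ∈ Θ, ∀ y, Z θ y - Z θ' y ≤ (2 * L) * ‖θ - θ'‖ := by
    intro θ hθ θ' hθ' y
    have h0 : ∀ i, |disc θ (D i) - disc θ' (D i)| ≤ L * ‖θ - θ'‖ := fun i =>
      hA3.2 θ hθ θ' hθ' (D i)
    have h1 : (∫ i, disc θ (D i) ∂U) - (∫ i, disc θ' (D i) ∂U) ≤ L * ‖θ - θ'‖ := by
      rw [← integral_sub .of_finite .of_finite]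
      have := integral_mono (μ := U) .of_finite (integrable_const _)
        fun i => (abs_le.1 (h0 i)).2
      simpa using this
    have h2 : (∑ j, disc θ' (D (y j))) / k - (∑ j, disc θ (D (y j))) / k ≤ L * ‖θ - θ'‖ := by
      rw [← sub_div, div_le_iff₀ hk0, ← Finset.sum_sub_distrib]
      calc ∑ j, (disc θ' (D (y j)) - disc θ (D (y j))) ≤ ∑ _j : Fin k, L * ‖θ - θ'‖ :=
            Finset.sum_le_sum fun j _ => by linarith [(abs_le.1 (h0 (y j))).1]
        _ = L * ‖θ - θ'‖ * k := by simp [mul_comm]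
    rw [hZ]
    dsimp only
    linarith
  have hFne : F.Nonempty := hF ▸ hΘ.image _
  have := hFne.to_subtype
  refine le_of_forall_pos_le_add fun η hη => ?_
  have hsel : ∀ y : Fin k → Fin m, ∃ θ ∈ Θ,
      ipm F (empiricalMeasure D) (empiricalMeasure fun j => D (y j)) ≤ Z θ y + η := by
    intro y
    obtain ⟨⟨f, hf⟩, h⟩ := exists_lt_of_lt_ciSup (sub_lt_self
      (ipm F (empiricalMeasure D) (empiricalMeasure fun j => D (y j))) hη)
    obtain ⟨θ, hθ, rfl⟩ : f ∈ disc '' Θ := hF ▸ hf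
    refine ⟨θ, hθ, ?_⟩
    rw [← hZ' θ hθ]
    dsimp only at h
    linarith
  choose θ hθ hle using hsel
  have h1 := integral_chaining_le hΘ hA3.1 (by positivity) hmean hsub hlip θ hθ
  have h2 := integral_mono (hint _) (hint _) hle
  rw [integral_add (hint _) (hint _)] at h2
  simp only [integral_const, probReal_univ, smul_eq_mul, one_mul] at h2
  rw [NNReal.coe_div, Real.coe_toNNReal L hL, Real.coe_sqrt, NNReal.coe_natCast] at h1
  have e : 16 * (L / √k) * (p : ℝ) = 16 * p * L / √k := by ring
  linarith

/-- With probability at least `1 - ξ`, a sample of size `k` is at distance less than `C_ξ / √k`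
from the database it is drawn from. -/
lemma measureReal_sampling_error_le (hF : F = disc '' Θ) (hΘ : Θ.Nonempty)
    (hmeas : ∀ f ∈ F, Measurable f) (hΔ : 0 < Δ) (hA2 : EvenBounded F Δ) (hL : 0 ≤ L)
    (hA3 : LipschitzParametrized disc Θ L) (hm : 0 < m) (hk : 0 < k) {ξ : ℝ} (hξ : 0 < ξ)
    (D : Fin m → X) :
    (Measure.pi fun _ : Fin k => uniformOn (Set.univ : Set (Fin m))).real
      {y | constC p L Δ ξ / √k
        ≤ ipm F (empiricalMeasure D) (empiricalMeasure fun j => D (y j))} ≤ ξ := by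
  have : NeZero m := ⟨hm.ne'⟩
  have := isProbabilityMeasure_uniformOn (Set.finite_univ (α := Fin m)) Set.univ_nonempty
  have := isProbabilityMeasure_empiricalMeasure hm D
  have : ∀ y : Fin k → Fin m, IsProbabilityMeasure (empiricalMeasure fun j => D (y j)) :=
    fun y => isProbabilityMeasure_empiricalMeasure hk _
  rcases le_or_gt 1 ξ with h1 | h1
  · exact measureReal_le_one.trans h1
  have hk0 : (0 : ℝ) < k := by positivity
  have hFne : F.Nonempty := hF ▸ hΘ.image _
  set Φ : (Fin k → Fin m) → ℝ := fun y =>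
    ipm F (empiricalMeasure D) (empiricalMeasure fun j => D (y j)) with hΦ
  have hbd1 : ∀ (y : Fin k → Fin m) (i : Fin k) (a : Fin m),
      ipm F (empiricalMeasure fun j => D (Function.update y i a j))
        (empiricalMeasure fun j => D (y j)) ≤ 2 * Δ / k := by
    intro y i a
    have e : (fun j => D (Function.update y i a j)) = Function.update (fun j => D (y j)) i (D a) :=
      Function.comp_update D y i a
    rw [e]
    exact ipm_empiricalMeasure_update_le hFne hA2 hmeas _ _ _
  have hbd : ∀ y i a, |Φ (Function.update y i a) - Φ y| ≤ (2 * Δ / k).toNNReal := by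
    intro y i a
    rw [Real.coe_toNNReal _ (by positivity), abs_sub_le_iff]
    have t1 := ipm_triangle hFne hA2 (empiricalMeasure D) (empiricalMeasure fun j => D (y j))
      (empiricalMeasure fun j => D (Function.update y i a j))
    have t2 := ipm_triangle hFne hA2 (empiricalMeasure D)
      (empiricalMeasure fun j => D (Function.update y i a j)) (empiricalMeasure fun j => D (y j))
    rw [ipm_comm hFne hA2 (empiricalMeasure fun j => D (y j))] at t1
    have := hbd1 y i a
    simp only [hΦ]
    constructor <;> linarith
  have hmc := hasSubgaussianMGF_of_bounded_differences (uniformOn (Set.univ : Set (Fin m))) _ k Φ hbd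
  have hlog : 0 ≤ Real.log (1 / ξ) := Real.log_nonneg (by rw [le_div_iff₀ hξ]; linarith)
  set t : ℝ := Δ * √(2 * Real.log (1 / ξ)) / √k with ht
  have ht0 : 0 ≤ t := by positivity
  have hmean := integral_ipm_empiricalMeasure_le (k := k) hF hΘ hmeas hL hA3 hm hk D
  have hC : 16 * p * L / √k + t ≤ constC p L Δ ξ / √k := by
    rw [ht, ← add_div, constC]
    have hpi : (1 : ℝ) ≤ √(2 * Real.pi) := by
      rw [Real.one_le_sqrt]; linarith [Real.pi_gt_three]
    have a1 : 16 * (p * L) * 1 ≤ 16 * (p * L) * √(2 * Real.pi) := by gcongr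
    have a2 : 0 ≤ Δ * √(2 * Real.log (1 / ξ)) := by positivity
    rw [div_le_div_iff_of_pos_right (by positivity)]
    linarith
  refine (measureReal_mono (fun y hy => ?_)).trans ((hmc.measure_ge_le ht0).trans_eq ?_)
  · simp only [Set.mem_ofPred_eq] at hy ⊢
    linarith
  · have e1 : t ^ 2 = Δ ^ 2 * (2 * Real.log (1 / ξ)) / k := by
      rw [ht, div_pow, mul_pow, Real.sq_sqrt (by positivity), Real.sq_sqrt hk0.le]
    have e2 : -t ^ 2 / (2 * ((k * ((2 * Δ / k).toNNReal / 2) ^ 2 : NNReal) : ℝ)) = Real.log ξ := by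
      rw [e1]
      push_cast
      rw [Real.coe_toNNReal _ (by positivity), one_div, Real.log_inv]
      field_simp
    rw [e2, Real.exp_log hξ]

end Sampling

/-! ### Differential privacy and expectations of bounded functions -/

/-- If the measures of all sets differ by at most `t`, the expectations of a function with values in
`[-Δ, Δ]` differ by at most `2 Δ t`. -/
lemma integral_sub_le_of_measureReal_le {X : Type*} [MeasurableSpace X] {μ ν : Measure X}
    [IsProbabilityMeasure μ] [IsProbabilityMeasure ν] {f : X → ℝ} (hf : Measurable f) {Δ t : ℝ}
    (hΔ : 0 ≤ Δ) (hfΔ : ∀ x, |f x| ≤ Δ) (h : ∀ S, MeasurableSet S → μ.real S ≤ ν.real S + t) :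
    ∫ x, f x ∂μ - ∫ x, f x ∂ν ≤ 2 * Δ * t := by
  have hfint : ∀ (κ : Measure X) [IsProbabilityMeasure κ], Integrable f κ := fun κ _ =>
    Integrable.of_bound hf.aestronglyMeasurable Δ (ae_of_all _ hfΔ)
  have hint : ∀ (κ : Measure X) [IsProbabilityMeasure κ], Integrable (fun x => f x + Δ) κ :=
    fun κ _ => (hfint κ).add (integrable_const _)
  have hlayer : ∀ (κ : Measure X) [IsProbabilityMeasure κ],
      ∫ x, f x ∂κ + Δ = ∫ s in Set.Ioc 0 (2 * Δ), κ.real {x | s ≤ f x + Δ} := by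
    intro κ _
    rw [← (hint κ).integral_eq_integral_Ioc_meas_le
      (ae_of_all _ fun x => by have := (abs_le.1 (hfΔ x)).1; simp only [Pi.zero_apply]; linarith)
      (ae_of_all _ fun x => by have := (abs_le.1 (hfΔ x)).2; dsimp only; linarith),
      integral_add (hfint κ) (integrable_const _)]
    simp
  have hanti : ∀ (κ : Measure X) [IsProbabilityMeasure κ],
      IntegrableOn (fun s => κ.real {x | s ≤ f x + Δ}) (Set.Ioc 0 (2 * Δ)) := by
    intro κ _
    have : Antitone fun s : ℝ => κ.real {x | s ≤ f x + Δ} := fun a b hab =>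
      measureReal_mono fun x hx => le_trans hab hx
    exact (this.locallyIntegrable.integrableOn_isCompact isCompact_Icc).mono_set
      Set.Ioc_subset_Icc_self
  have h1 : ∫ s in Set.Ioc 0 (2 * Δ), μ.real {x | s ≤ f x + Δ}
      ≤ ∫ s in Set.Ioc 0 (2 * Δ), (ν.real {x | s ≤ f x + Δ} + t) :=
    integral_mono (hanti μ) ((hanti ν).add (integrable_const _)) fun s =>
      h _ (measurableSet_le measurable_const (hf.add_const Δ))
  rw [integral_add (hanti ν) (integrable_const _), ← hlayer μ, ← hlayer ν] at h1
  simp only [integral_const, measureReal_restrict_apply_univ, Real.volume_real_Ioc, sub_zero,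
    smul_eq_mul, max_eq_left (show (0 : ℝ) ≤ 2 * Δ by positivity)] at h1
  linarith

/-- The two one-sided `(ε, δ)` constraints, for a set and for its complement with the roles
exchanged, bound the total variation distance by `(2 δ + e^ε - 1) / (e^ε + 1)`. -/
lemma integral_sub_le_of_indistinguishable {X : Type*} [MeasurableSpace X] {μ ν : Measure X}
    [IsProbabilityMeasure μ] [IsProbabilityMeasure ν] {f : X → ℝ} (hf : Measurable f)
    {Δ ε δ : ℝ} (hΔ : 0 ≤ Δ) (hfΔ : ∀ x, |f x| ≤ Δ)
    (h₁ : ∀ S, MeasurableSet S → μ.real S ≤ Real.exp ε * ν.real S + δ)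
    (h₂ : ∀ S, MeasurableSet S → ν.real S ≤ Real.exp ε * μ.real S + δ) :
    (Real.exp ε + 1) * (∫ x, f x ∂μ - ∫ x, f x ∂ν) ≤ 2 * Δ * (2 * δ + Real.exp ε - 1) := by
  have he : 0 < Real.exp ε + 1 := by positivity
  have h := integral_sub_le_of_measureReal_le (μ := μ) (ν := ν) hf hΔ hfΔ
    (t := (2 * δ + Real.exp ε - 1) / (Real.exp ε + 1)) fun S hS => by
      have a := h₁ S hS
      have b := h₂ Sᶜ hS.compl
      rw [probReal_compl_eq_one_sub hS, probReal_compl_eq_one_sub hS] at b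
      rw [← sub_le_iff_le_add', le_div_iff₀ he]
      nlinarith
  rw [← mul_div_assoc, le_div_iff₀ he] at h
  linarith

/-- The lower bound `δ ≥ (e^ε + 1) a / 2 - (e^ε - 1) / 2` implies the linear one `δ ≥ a - ε` when
`ε ≤ a`, because `e^ε (1 - ε) ≤ 1`. -/
lemma sub_le_of_le {a ε δ : ℝ} (hε : 0 ≤ ε) (ha : ε ≤ a)
    (h : (Real.exp ε + 1) * a ≤ 2 * δ + Real.exp ε - 1) : a - ε ≤ δ := by
  have h1 : 1 ≤ Real.exp ε := Real.one_le_exp hε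
  have h2 : Real.exp ε * (1 - ε) ≤ 1 := by
    have := Real.add_one_le_exp (-ε)
    calc Real.exp ε * (1 - ε) ≤ Real.exp ε * Real.exp (-ε) := by gcongr; linarith
      _ = 1 := by rw [← Real.exp_add, add_neg_cancel, Real.exp_zero]
  nlinarith

/-! ### Generalization error of the trained generator -/

section Training

variable {X : Type*} [MeasurableSpace X] {F : Set (X → ℝ)} {G : Set (ProbabilityMeasure X)}
  {Δ L τ ξ : ℝ} {p m k : ℕ}

/-- A generator trained on samples close to the database is close to the database. The distance of
the samples to the database enters twice: directly, and through the best approximation in `G`. -/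
lemma ipm_train_le {Seed : Type*} {train : Seed → (Fin k → X) → ProbabilityMeasure X}
    (htrain : IsTrainer F G τ train) (hne : F.Nonempty) (hF : EvenBounded F Δ)
    (hm : 0 < m) (hk : 0 < k) (D : Fin m → X) (T : Fin k → X) (s : Seed)
    (hT : ipm F (empiricalMeasure D) (empiricalMeasure T) ≤ constC p L Δ ξ / √k) :
    ipm F (empiricalMeasure D) (train s T : Measure X)
      ≤ genError F G p L Δ τ k ξ (empiricalMeasure D) := by
  have := isProbabilityMeasure_empiricalMeasure hm D
  have := isProbabilityMeasure_empiricalMeasure hk T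
  obtain ⟨hg, ht⟩ := htrain s T
  have hτ : 0 ≤ τ := (sub_nonneg.2 (approxError_le_ipm hne hF hg _)).trans ht
  have h0 := approxError_nonneg (G := G) hne hF (empiricalMeasure D)
  have h1 := ipm_triangle hne hF (empiricalMeasure D) (empiricalMeasure T) (train s T : Measure X)
  have h2 := approxError_le_add hne hF ⟨_, hg⟩ (empiricalMeasure T) (empiricalMeasure D)
  rw [ipm_comm hne hF (empiricalMeasure T)] at h2
  rw [genError]
  linarith

lemma genError_le_genErrorUnif (hne : F.Nonempty) (hF : EvenBounded F Δ) (hG : G.Nonempty)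
    (hm : 0 < m) (D : Fin m → X) :
    genError F G p L Δ τ k ξ (empiricalMeasure D) ≤ genErrorUnif F G p L Δ τ m k ξ := by
  obtain ⟨g, hg⟩ := hG
  refine le_ciSup (f := fun D : Fin m → X => genError F G p L Δ τ k ξ (empiricalMeasure D))
    ⟨2 * (2 * Δ + τ + constC p L Δ ξ / √k), ?_⟩ D
  rintro _ ⟨D', rfl⟩
  have := isProbabilityMeasure_empiricalMeasure hm D'
  have h1 := approxError_le_ipm hne hF hg (empiricalMeasure D')
  have h2 := ipm_le_two_mul hne hF (empiricalMeasure D') (g : Measure X)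
  simp only [genError]
  linarith

/-- If the generators trained on a constant database and on a neighbor of it are both within `B` of
their databases, privacy of the mechanism bounds the oscillation of every discriminator. -/
lemma mul_le_of_isDifferentiallyPrivate {M : (Fin m → X) → ProbabilityMeasure X}
    (hF : EvenBounded F Δ) (hmeas : ∀ f ∈ F, Measurable f) (hΔ : 0 ≤ Δ) (hm : 0 < m)
    {f : X → ℝ} (hf : f ∈ F) (x y : X) (i : Fin m) {B ε δ : ℝ}
    (h₀ : ipm F (empiricalMeasure fun _ : Fin m => x) (M fun _ => x : Measure X) ≤ B)
    (h₁ : ipm F (empiricalMeasure (Function.update (fun _ => x) i y))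
      (M (Function.update (fun _ => x) i y) : Measure X) ≤ B)
    (hdp : IsDifferentiallyPrivate (fun D => Measure.pi fun _ : Fin 1 => (M D : Measure X)) ε δ) :
    (Real.exp ε + 1) * ((f x - f y) / m - 2 * B) ≤ 2 * Δ * (2 * δ + Real.exp ε - 1) := by
  set D₀ : Fin m → X := fun _ => x with hD₀
  set D₁ : Fin m → X := Function.update D₀ i y with hD₁
  have := isProbabilityMeasure_empiricalMeasure hm D₀
  have := isProbabilityMeasure_empiricalMeasure hm D₁
  have hnb : ∀ j, D₀ j ≠ D₁ j → j = i := by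
    intro j hj
    by_contra hji
    exact hj (by rw [hD₁, Function.update_of_ne hji])
  have hN₀ : Neighboring D₀ D₁ := by
    refine (Set.ncard_le_ncard (t := {i}) (fun j hj => hnb j hj)).trans (by simp)
  have hN₁ : Neighboring D₁ D₀ := by
    refine (Set.ncard_le_ncard (t := {i}) (fun j hj => hnb j (Ne.symm hj))).trans (by simp)
  have hreal : ∀ D (S : Set X), MeasurableSet S →
      (Measure.pi fun _ : Fin 1 => (M D : Measure X)).real (Function.eval 0 ⁻¹' S)
        = (M D : Measure X).real S := fun D S hS =>
    (measurePreserving_eval (fun _ : Fin 1 => (M D : Measure X)) 0).measureReal_preimage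
      hS.nullMeasurableSet
  have hind : ∀ D D', Neighboring D D' → ∀ S, MeasurableSet S →
      (M D : Measure X).real S ≤ Real.exp ε * (M D' : Measure X).real S + δ := by
    intro D D' hDD S hS
    have := hdp D D' hDD _ (measurable_pi_apply (0 : Fin 1) hS)
    dsimp only at this
    rwa [← hreal D S hS, ← hreal D' S hS]
  have h := integral_sub_le_of_indistinguishable (hmeas f hf) hΔ (hF.2 f hf)
    (hind _ _ hN₀) (hind _ _ hN₁)
  have hgap : (∫ z, f z ∂empiricalMeasure D₀) - ∫ z, f z ∂empiricalMeasure D₁ = (f x - f y) / m := by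
    rw [integral_empiricalMeasure _ (hmeas f hf), integral_empiricalMeasure _ (hmeas f hf),
      ← sub_div, ← Finset.sum_sub_distrib, Finset.sum_eq_single i]
    · rw [hD₁, Function.update_self]
    · intro j _ hj
      rw [hD₁, Function.update_of_ne hj, sub_self]
    · simp
  have a := sub_le_ipm hF hf (empiricalMeasure D₀) (M D₀ : Measure X)
  have b := sub_le_ipm_swap hF hf (empiricalMeasure D₁) (M D₁ : Measure X)
  refine le_trans (mul_le_mul_of_nonneg_left ?_ (by positivity)) h
  linarith

/-- The event, for one database, that the training sample drawn from it is closer than `C_ξ / √k`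
has probability at least `1 - ξ`. -/
lemma measurableSet_and_measureReal_compl_draws_close_le {Ω : Type*} [MeasurableSpace Ω] {P : Measure Ω}
    [IsProbabilityMeasure P] {disc : EuclideanSpace ℝ (Fin p) → X → ℝ}
    {Θ : Set (EuclideanSpace ℝ (Fin p))} (hF : F = disc '' Θ) (hΘ : Θ.Nonempty)
    (hmeas : ∀ f ∈ F, Measurable f) (hΔ : 0 < Δ) (hA2 : EvenBounded F Δ) (hL : 0 ≤ L)
    (hA3 : LipschitzParametrized disc Θ L) (hm : 0 < m) (hk : 0 < k) (hξ : 0 < ξ)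
    {idx : (Fin m → X) → Ω → Fin k → Fin m} (hidx : IIDUniformDraws P idx) (D : Fin m → X) :
    MeasurableSet {ω | ipm F (empiricalMeasure D) (empiricalMeasure fun j => D (idx D ω j))
        < constC p L Δ ξ / √k} ∧
      P.real {ω | ipm F (empiricalMeasure D) (empiricalMeasure fun j => D (idx D ω j))
        < constC p L Δ ξ / √k}ᶜ ≤ ξ := by
  obtain ⟨h1, h2⟩ := hidx D
  set B : Set (Fin k → Fin m) := {y | constC p L Δ ξ / √k
    ≤ ipm F (empiricalMeasure D) (empiricalMeasure fun j => D (y j))} with hB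
  have e : {ω | ipm F (empiricalMeasure D) (empiricalMeasure fun j => D (idx D ω j))
      < constC p L Δ ξ / √k}ᶜ = idx D ⁻¹' B := by
    ext ω
    simp [hB]
  have hBm : MeasurableSet B := .of_discrete
  refine ⟨?_, ?_⟩
  · rw [← MeasurableSet.compl_iff, e]
    exact h1 hBm
  · rw [e, ← map_measureReal_apply h1 hBm, h2]
    exact measureReal_sampling_error_le hF hΘ hmeas hΔ hA2 hL hA3 hm hk hξ D

end Training

/-! ### Failure of differential privacy -/

/-- The superior limit of events of probability at least `c` has probability at least `c`. -/
lemma le_measureReal_frequently {Ω : Type*} [MeasurableSpace Ω] {P : Measure Ω}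
    [IsProbabilityMeasure P] {A : ℕ → Set Ω} (hA : ∀ n, MeasurableSet (A n)) {c : ℝ}
    (hc : ∀ n, c ≤ P.real (A n)) :
    MeasurableSet (⋂ N, ⋃ n ≥ N, A n) ∧ c ≤ P.real (⋂ N, ⋃ n ≥ N, A n) := by
  have hU : ∀ N : ℕ, MeasurableSet (⋃ n ≥ N, A n) := fun N =>
    .iUnion fun n => .iUnion fun _ => hA n
  refine ⟨.iInter hU, ?_⟩
  have hanti : Antitone fun N : ℕ => ⋃ n ≥ N, A n := fun M N hMN =>
    Set.biUnion_subset_biUnion_left fun n hn => le_trans hMN hn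
  have hlim := tendsto_measure_iInter_atTop (μ := P) (fun N => (hU N).nullMeasurableSet) hanti
    ⟨0, measure_ne_top _ _⟩
  have hlim' := (ENNReal.tendsto_toReal (measure_ne_top P _)).comp hlim
  refine ge_of_tendsto' hlim' fun N => (hc N).trans ?_
  exact measureReal_mono (Set.subset_iUnion₂ (s := fun n (_ : n ≥ N) => A n) N le_rfl)
    (measure_ne_top _ _)

lemma exists_oscillation_lt {X : Type*} [Nonempty X] {F : Set (X → ℝ)} (hne : F.Nonempty) {c : ℝ}
    (hc : c < oscillation F) : ∃ f ∈ F, ∃ x y, c < f x - f y := by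
  have := hne.to_subtype
  obtain ⟨⟨f, hf⟩, h⟩ := exists_lt_of_lt_ciSup hc
  obtain ⟨⟨x, y⟩, h⟩ := exists_lt_of_lt_ciSup h
  dsimp only at h
  rcases abs_cases (f x - f y) with ⟨e, -⟩ | ⟨e, -⟩
  · exact ⟨f, hf, x, y, by rwa [e] at h⟩
  · exact ⟨f, hf, y, x, by linarith⟩

end GanPrivacy

theorem proposition2 {X Seed Ω : Type*} [MeasurableSpace X] [Nonempty X] [MeasurableSpace Ω]
    (lam : Measure X) [SigmaFinite lam]
    (G : Set (ProbabilityMeasure X))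
    (p : ℕ) (disc : EuclideanSpace ℝ (Fin p) → X → ℝ) (Θ : Set (EuclideanSpace ℝ (Fin p)))
    (F : Set (X → ℝ)) (hF : F = disc '' Θ) (hΘ : Θ.Nonempty)
    (hmeas : ∀ f ∈ F, Measurable f)
    (hA1 : GanPrivacy.LogRatiosInSpan lam F G)
    (Δ : ℝ) (hΔ : 0 < Δ) (hA2 : GanPrivacy.EvenBounded F Δ)
    (L : ℝ) (hL : 0 ≤ L) (hA3 : GanPrivacy.LipschitzParametrized disc Θ L)
    (m k : ℕ) (hm : 0 < m) (hk : 0 < k) (ξ : ℝ) (hξ : 0 < ξ)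
    (τ : ℝ) (train : Seed → (Fin k → X) → ProbabilityMeasure X)
    (htrain : GanPrivacy.IsTrainer F G τ train)
    (P : Measure Ω) [IsProbabilityMeasure P]
    (idx : (Fin m → X) → Ω → Fin k → Fin m) (hidx : GanPrivacy.IIDUniformDraws P idx)
    (seed : (Fin m → X) → Ω → Seed) :
    ∃ E : Set Ω, MeasurableSet E ∧ 1 - 2 * ξ ≤ P.real E ∧ ∀ ω ∈ E, ∀ ε : ℝ, 0 ≤ ε →
      (∀ δ : ℝ,
        δ < (Real.exp ε + 1) / (2 * Δ) *
              (GanPrivacy.oscillation F / (2 * m) - GanPrivacy.genErrorUnif F G p L Δ τ m k ξ)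
            + 1 - Real.exp ε →
        ¬ GanPrivacy.IsDifferentiallyPrivate (GanPrivacy.ganMechanism train idx seed 1 ω) ε δ) ∧
      (ε ≤ 1 / Δ *
          (GanPrivacy.oscillation F / (2 * m) - GanPrivacy.genErrorUnif F G p L Δ τ m k ξ) →
        ∀ δ : ℝ,
          δ < 1 / Δ *
              (GanPrivacy.oscillation F / (2 * m) - GanPrivacy.genErrorUnif F G p L Δ τ m k ξ)
            - ε →
          ¬ GanPrivacy.IsDifferentiallyPrivate (GanPrivacy.ganMechanism train idx seed 1 ω) ε δ) := by
  classical
  have hFne : F.Nonempty := hF ▸ hΘ.image _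
  obtain ⟨ω₀⟩ := nonempty_of_isProbabilityMeasure P
  have hG : G.Nonempty :=
    ⟨_, (htrain (seed (fun _ => Classical.arbitrary X) ω₀) fun _ => Classical.arbitrary X).1⟩
  set W := GanPrivacy.oscillation F with hW
  set B := GanPrivacy.genErrorUnif F G p L Δ τ m k ξ with hB
  -- The oscillation need not be attained: a sequence of pairs of databases approaches it, and the
  -- event `E` is that the training samples of infinitely many of these pairs are good.
  have hseq : ∀ n : ℕ, ∃ f ∈ F, ∃ x y, W - 1 / ((n : ℝ) + 1) < f x - f y := fun n =>
    GanPrivacy.exists_oscillation_lt hFne (sub_lt_self _ (by positivity))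
  choose f hf x y hfxy using hseq
  set D₀ : ℕ → Fin m → X := fun n _ => x n with hD₀
  set D₁ : ℕ → Fin m → X := fun n => Function.update (D₀ n) ⟨0, hm⟩ (y n) with hD₁
  set good : (Fin m → X) → Set Ω := fun D =>
    {ω | GanPrivacy.ipm F (GanPrivacy.empiricalMeasure D)
      (GanPrivacy.empiricalMeasure fun j => D (idx D ω j)) < GanPrivacy.constC p L Δ ξ / √k}
    with hgood
  have hgoodP : ∀ D, MeasurableSet (good D) ∧ P.real (good D)ᶜ ≤ ξ :=
    GanPrivacy.measurableSet_and_measureReal_compl_draws_close_le hF hΘ hmeas hΔ hA2 hL hA3 hm hk hξ hidx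
  have hA : ∀ n, MeasurableSet (good (D₀ n) ∩ good (D₁ n)) := fun n =>
    (hgoodP _).1.inter (hgoodP _).1
  have hAP : ∀ n, 1 - 2 * ξ ≤ P.real (good (D₀ n) ∩ good (D₁ n)) := by
    intro n
    have h1 := probReal_compl_eq_one_sub (μ := P) (hA n)
    rw [Set.compl_inter] at h1
    have h2 := measureReal_union_le (μ := P) (good (D₀ n))ᶜ (good (D₁ n))ᶜ
    linarith [(hgoodP (D₀ n)).2, (hgoodP (D₁ n)).2]
  obtain ⟨hEm, hEP⟩ := GanPrivacy.le_measureReal_frequently hA hAP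
  refine ⟨_, hEm, hEP, fun ω hω ε hε => ?_⟩
  have hfreq : ∃ᶠ n in Filter.atTop, ω ∈ good (D₀ n) ∩ good (D₁ n) := by
    rw [Filter.frequently_atTop]
    intro N
    obtain ⟨n, hn, h⟩ := Set.mem_iUnion₂.1 (Set.mem_iInter.1 hω N)
    exact ⟨n, hn, h⟩
  have hclose : ∀ D, ω ∈ good D → GanPrivacy.ipm F (GanPrivacy.empiricalMeasure D)
      (train (seed D ω) (fun j => D (idx D ω j)) : Measure X) ≤ B := fun D hD =>
    (GanPrivacy.ipm_train_le htrain hFne hA2 hm hk D _ _ (le_of_lt hD)).trans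
      (GanPrivacy.genError_le_genErrorUnif hFne hA2 hG hm D)
  have key : ∀ δ, GanPrivacy.IsDifferentiallyPrivate
      (GanPrivacy.ganMechanism train idx seed 1 ω) ε δ →
      (Real.exp ε + 1) * (1 / Δ * (W / (2 * m) - B)) ≤ 2 * δ + Real.exp ε - 1 := by
    intro δ hdp
    have hlim : Filter.Tendsto
        (fun n : ℕ => (Real.exp ε + 1) * ((W - 1 / ((n : ℝ) + 1)) / m - 2 * B)) Filter.atTop
        (nhds ((Real.exp ε + 1) * ((W - 0) / m - 2 * B))) :=
      (((tendsto_one_div_add_atTop_nhds_zero_nat.const_sub W).div_const _).sub_const _).const_mul _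
    have h1 : (Real.exp ε + 1) * ((W - 0) / m - 2 * B) ≤ 2 * Δ * (2 * δ + Real.exp ε - 1) := by
      refine le_of_tendsto_of_frequently hlim (hfreq.mono fun n hn => ?_)
      refine le_trans ?_ (GanPrivacy.mul_le_of_isDifferentiallyPrivate hA2 hmeas hΔ.le hm (hf n)
        (x n) (y n) ⟨0, hm⟩ (M := fun D => train (seed D ω) fun j => D (idx D ω j))
        (hclose (D₀ n) hn.1) (hclose (D₁ n) hn.2) hdp)
      have := (hfxy n).le
      gcongr
    have hm0 : (0 : ℝ) < m := by exact_mod_cast hm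
    have e : (Real.exp ε + 1) * ((W - 0) / m - 2 * B)
        = 2 * Δ * ((Real.exp ε + 1) * (1 / Δ * (W / (2 * m) - B))) := by
      field_simp
      ring
    rw [e] at h1
    exact le_of_mul_le_mul_left h1 (by positivity)
  refine ⟨fun δ hδ hdp => ?_, fun hεa δ hδ hdp => ?_⟩
  · have h1 := key δ hdp
    have h2 : (Real.exp ε + 1) / (2 * Δ) * (W / (2 * m) - B)
        = (Real.exp ε + 1) * (1 / Δ * (W / (2 * m) - B)) / 2 := by
      field_simp
    have h3 := Real.one_le_exp hε
    linarith
  · exact absurd (GanPrivacy.sub_le_of_le hε hεa (key δ hdp)) (not_le.2 hδ)
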